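/- A biframe $\mathcal{L}=(L^+,L^-,L)$ consists of frames $L^+,L^-,L$ and injective frame homomorphisms $e^\pm:L^\pm\to L$ such that every element of $L$ is of the form $\bigvee_i e^+(x_i^+)\wedge e^-(x_i^-)$. A morphism $\mathcal{L}\to\mathcal{M}$ is a pair of frame homomorphisms $f^\pm:L^\pm\to M^\pm$ for which there is a frame homomorphism $f:L\to M$ with $f\circ e_L^\pm=e_M^\pm\circ f^\pm$. The biframe $\mathcal{L}$ is finitary if the kernel congruence of the canonical homomorphism $L^+\oplus L^-\to L$ from the frame coproduct is generated by a set of pairs of finitary elements, that is, of finite joins of elements $x^+\wedge x^-$ with $x^\pm\in L^\pm$. A bispace $X$ is a set with two topologies $\Omega^+(X)$, $\Omega^-(X)$ (the positive and the negative one). A bihomeomorphism is a map that is a homeomorphism for the positive and for the negative topologies. A bisubspace is a subset with the two subspace topologies. The patch topology of $X$ is the topology generated by $\Omega^+(X)\cup\Omega^-(X)$. The Skula bispace $Sk(X)$ has the same points; its positive topology is generated by the positive open and the negative closed sets of $X$, its negative topology by the negative open and the positive closed sets of $X$. The bispectrum $\mathsf{bpt}(\mathcal{L})$ is the set of biframe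 morphisms $(f^+,f^-):\mathcal{L}\to(2,2,2)$, whose positive opens are the sets $\varphi^+(a^+)=\{(f^+,f^-):f^+(a^+)=1\}$ for $a^+\in L^+$, and whose negative opens are the sets $\varphi^-(a^-)=\{(f^+,f^-):f^-(a^-)=1\}$ for $a^-\in L^-$. For a bispace $X$ let $\mathsf{b}\Omega_{\mathsf{fin}}(X)=(\Omega^+(X),\Omega^-(X),\Omega_{\mathsf{fin}}(X))$, where $\Omega_{\mathsf{fin}}(X)$ is the quotient of $\Omega^+(X)\oplus\Omega^-(X)$ by the inequalities $U^+\wedge U^-\le V^+\vee V^-$ for all $U^\pm,V^\pm\in\Omega^\pm(X)$ with $U^+\cap U^-\subseteq V^+\cup V^-$. The bispace $X$ is bisober if the map $\psi_X:X\to\mathsf{bpt}(\mathsf{b}\Omega_{\mathsf{fin}}(X))$ that sends $x$ to its pair of neighbourhood maps $(N_x^+,N_x^-)$, where $N_x^\pm(U)=1$ if and only if $x\in U$, is a bihomeomorphism. **Theorem.** Let $\mathcal{L}$ be a finitary biframe and let $Y$ be a set of points of $\mathsf{bpt}(\mathcal{L})$. 1. The bisubspace $Y$ of $\mathsf{bpt}(\mathcal{L})$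 is bisober if and only if $Y$ is closed in the patch topology of the Skula bispace $Sk(\mathsf{bpt}(\mathcal{L}))$. 2. The bisubspace $Y$ of $\mathsf{bpt}(\mathcal{L})$ is bisober if and only if $$Y=\bigcap_{i\in I}\bigl(\varphi^+(a_i^+)^c\cup\varphi^+(b_i^+)\cup\varphi^-(a_i^-)^c\cup\varphi^-(b_i^-)\bigr)$$ for some (possibly empty) index set $I$ and families $a_i^+,b_i^+\in L^+$ and $a_i^-,b_i^-\in L^-$. -/

import Mathlib

open TopologicalSpace Topology

universe u v w

/-! ## Frame congruences and quotient frames -/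

/-- A frame congruence: an equivalence relation compatible with binary meets and arbitrary joins. -/
structure FrameCon (L : Type u) [Order.Frame L] extends Setoid L where
  inf_compat : ∀ {a b c d : L}, r a b → r c d → r (a ⊓ c) (b ⊓ d)
  sSup_compat : ∀ S : Set (L × L), (∀ p ∈ S, r p.1 p.2) →
    r (sSup (Prod.fst '' S)) (sSup (Prod.snd '' S))

namespace FrameCon

section

variable {L : Type u} [Order.Frame L]

theorem iSup_compat (C : FrameCon L) {ι : Sort w} {f g : ι → L} (h : ∀ i, C.r (f i) (g i)) :
    C.r (⨆ i, f i) (⨆ i, g i) := by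
  have := C.sSup_compat (Set.range fun i => (f i, g i)) (by rintro _ ⟨i, rfl⟩; exact h i)
  rwa [← Set.range_comp, ← Set.range_comp] at this

/-- The kernel congruence of a frame homomorphism. -/
def ker {M : Type v} [Order.Frame M] (f : FrameHom L M) : FrameCon L where
  r a b := f a = f b
  iseqv := ⟨fun _ => rfl, fun h => h.symm, fun h h' => h.trans h'⟩
  inf_compat := by
    intro a b c d h h'
    simp only [map_inf] at *
    rw [h, h']
  sSup_compat := by
    intro S h
    simp only [map_sSup, Set.image_image]
    rw [Set.image_congr h]

/-- The smallest frame congruence containing the relation `R`. -/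
def gen (R : L → L → Prop) : FrameCon L where
  r a b := ∀ C : FrameCon L, (∀ x y, R x y → C.r x y) → C.r a b
  iseqv := ⟨fun a C _ => C.iseqv.refl a, fun h C hC => C.iseqv.symm (h C hC),
    fun h h' C hC => C.iseqv.trans (h C hC) (h' C hC)⟩
  inf_compat := fun h h' C hC => C.inf_compat (h C hC) (h' C hC)
  sSup_compat := fun S h C hC => C.sSup_compat S fun p hp => h p hp C hC

/-- The quotient frame `L/C`. -/
def Quot (C : FrameCon L) : Type u := Quotient C.toSetoid

variable (C : FrameCon L)

/-- The underlying map of the quotient homomorphism `L → L/C`. -/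
def proj (a : L) : C.Quot := Quotient.mk C.toSetoid a

theorem proj_eq {a b : L} : C.proj a = C.proj b ↔ C.r a b :=
  Quotient.eq (r := C.toSetoid)

theorem proj_surj (x : C.Quot) : ∃ a, C.proj a = x := Quotient.exists_rep x

instance : PartialOrder C.Quot where
  le x y := ∃ a b, C.proj a = x ∧ C.proj b = y ∧ a ≤ b
  le_refl x := by
    obtain ⟨a, rfl⟩ := C.proj_surj x
    exact ⟨a, a, rfl, rfl, le_rfl⟩
  le_trans := by
    rintro x y z ⟨a, b, rfl, rfl, hab⟩ ⟨b', c, hb, rfl, hbc⟩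
    refine ⟨a ⊓ b', c, ?_, rfl, inf_le_right.trans hbc⟩
    have := C.inf_compat (C.iseqv.refl a) (C.proj_eq.1 hb)
    rw [inf_eq_left.2 hab] at this
    exact C.proj_eq.2 this
  le_antisymm := by
    rintro x y ⟨a, b, rfl, rfl, hab⟩ ⟨b', a', hb, ha, hba⟩
    rw [C.proj_eq] at *
    have h1 := C.inf_compat (C.iseqv.refl a) hb
    have h2 := C.inf_compat ha hb
    rw [inf_eq_left.2 hab] at h1 h2
    rw [inf_eq_right.2 hba] at h2
    exact C.iseqv.trans (C.iseqv.symm h2) hb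

theorem proj_le {a b : L} : C.proj a ≤ C.proj b ↔ C.r (a ⊓ b) a := by
  constructor
  · rintro ⟨a', b', ha, hb, hab⟩
    rw [C.proj_eq] at ha hb
    have h := C.inf_compat ha hb
    rw [inf_eq_left.2 hab] at h
    exact C.iseqv.trans (C.iseqv.symm h) ha
  · intro h
    exact ⟨a ⊓ b, b, C.proj_eq.2 h, rfl, inf_le_right⟩

instance : Min C.Quot where
  min := Quotient.map₂ (sa := C.toSetoid) (sb := C.toSetoid) (sc := C.toSetoid) (· ⊓ ·)
    fun _ _ h _ _ h' => C.inf_compat h h'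

theorem proj_inf (a b : L) : C.proj (a ⊓ b) = C.proj a ⊓ C.proj b := rfl

instance : SupSet C.Quot where
  sSup S := C.proj (sSup {a | C.proj a ∈ S})

theorem isLUB_sSup_quot (S : Set C.Quot) : IsLUB S (sSup S) := by
  constructor
  · intro x hx
    obtain ⟨a, rfl⟩ := C.proj_surj x
    exact ⟨a, _, rfl, rfl, le_sSup hx⟩
  · intro y hy
    obtain ⟨c, rfl⟩ := C.proj_surj y
    refine (C.proj_le (a := sSup {a | C.proj a ∈ S})).2 ?_
    rw [sSup_eq_iSup, iSup₂_inf_eq]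
    exact C.iSup_compat fun a => C.iSup_compat fun ha => C.proj_le.1 (hy ha)

instance : CompleteLattice C.Quot :=
  { completeLatticeOfSup C.Quot C.isLUB_sSup_quot with
    inf := Min.min
    inf_le_left := by
      intro x y
      obtain ⟨a, rfl⟩ := C.proj_surj x
      obtain ⟨b, rfl⟩ := C.proj_surj y
      exact ⟨a ⊓ b, a, rfl, rfl, inf_le_left⟩
    inf_le_right := by
      intro x y
      obtain ⟨a, rfl⟩ := C.proj_surj x
      obtain ⟨b, rfl⟩ := C.proj_surj y
      exact ⟨a ⊓ b, b, rfl, rfl, inf_le_right⟩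
    le_inf := by
      intro x y z hxy hxz
      obtain ⟨a, rfl⟩ := C.proj_surj x
      obtain ⟨b, rfl⟩ := C.proj_surj y
      obtain ⟨c, rfl⟩ := C.proj_surj z
      rw [C.proj_le] at hxy hxz
      rw [← C.proj_inf, C.proj_le]
      have h := C.inf_compat hxy hxz
      rwa [← inf_inf_distrib_left, inf_idem] at h }

theorem proj_iSup {ι : Sort w} (f : ι → L) : C.proj (⨆ i, f i) = ⨆ i, C.proj (f i) := by
  apply le_antisymm
  · obtain ⟨c, hc⟩ := C.proj_surj (⨆ i, C.proj (f i))
    rw [← hc, C.proj_le, iSup_inf_eq]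
    refine C.iSup_compat fun i => C.proj_le.1 ?_
    rw [hc]
    exact le_iSup (fun i => C.proj (f i)) i
  · exact iSup_le fun i => ⟨f i, _, rfl, rfl, le_iSup f i⟩

instance : Order.Frame C.Quot :=
  Order.Frame.ofMinimalAxioms
    { inf_sSup_le_iSup_inf := by
        intro x S
        obtain ⟨a, rfl⟩ := C.proj_surj x
        have h : sSup S = C.proj (sSup {a | C.proj a ∈ S}) := rfl
        rw [h]
        change C.proj (a ⊓ sSup {a | C.proj a ∈ S}) ≤ _
        rw [sSup_eq_iSup, inf_iSup₂_eq, C.proj_iSup]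
        refine iSup_le fun b => ?_
        rw [C.proj_iSup]
        exact iSup_le fun hb => le_iSup₂ (f := fun y (_ : y ∈ S) => C.proj a ⊓ y) (C.proj b) hb }

/-- The quotient homomorphism `L → L/C`. -/
def quotHom : FrameHom L C.Quot where
  toFun := C.proj
  map_inf' := C.proj_inf
  map_top' := top_unique (by
    obtain ⟨a, ha⟩ := C.proj_surj ⊤
    exact ⟨a, ⊤, ha, rfl, le_top⟩)
  map_sSup' S := by
    rw [sSup_image, sSup_eq_iSup, C.proj_iSup]
    exact iSup_congr fun a => C.proj_iSup _

/-- A frame homomorphism that respects `R` factors through the quotient by the congruence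
generated by `R`. -/
def lift {R : L → L → Prop} {M : Type v} [Order.Frame M] (f : FrameHom L M)
    (h : ∀ x y, R x y → f x = f y) : FrameHom (gen R).Quot M where
  toFun := Quotient.lift (s := (gen R).toSetoid) f fun _ _ hab => hab (ker f) h
  map_inf' x y := by
    obtain ⟨a, rfl⟩ := proj_surj _ x
    obtain ⟨b, rfl⟩ := proj_surj _ y
    exact map_inf f a b
  map_top' := by
    rw [← map_top (gen R).quotHom]
    exact map_top f
  map_sSup' S := by
    refine Eq.trans (map_sSup f {a | (gen R).proj a ∈ S}) (congrArg sSup ?_)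
    ext m
    constructor
    · rintro ⟨a, ha, rfl⟩
      exact ⟨_, ha, rfl⟩
    · rintro ⟨x, hx, rfl⟩
      obtain ⟨a, rfl⟩ := proj_surj _ x
      exact ⟨a, hx, rfl⟩

end

end FrameCon

/-! ## The coproduct of two frames -/

/-- The elements of the frame coproduct `A ⊕ B`: down-sets of `A × B` closed under joins in each
coordinate (including the empty joins). -/
@[ext]
structure FrameCoprod (A : Type u) (B : Type v) [Order.Frame A] [Order.Frame B] where
  carrier : Set (A × B)
  lower : ∀ {p q : A × B}, p ≤ q → q ∈ carrier → p ∈ carrier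
  sSup_left : ∀ (S : Set A) (b : B), (∀ a ∈ S, (a, b) ∈ carrier) → (sSup S, b) ∈ carrier
  sSup_right : ∀ (a : A) (S : Set B), (∀ b ∈ S, (a, b) ∈ carrier) → (a, sSup S) ∈ carrier

namespace FrameCoprod

section

variable {A : Type u} {B : Type v} [Order.Frame A] [Order.Frame B]

instance : PartialOrder (FrameCoprod A B) where
  le D E := D.carrier ⊆ E.carrier
  le_refl _ := subset_rfl
  le_trans _ _ _ h h' := h.trans h'
  le_antisymm _ _ h h' := FrameCoprod.ext (h.antisymm h')

instance : InfSet (FrameCoprod A B) where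
  sInf 𝒟 :=
    { carrier := {p | ∀ D ∈ 𝒟, p ∈ D.carrier}
      lower := fun h hq D hD => D.lower h (hq D hD)
      sSup_left := fun S b h D hD => D.sSup_left S b fun a ha => h a ha D hD
      sSup_right := fun a S h D hD => D.sSup_right a S fun b hb => h b hb D hD }

instance : Min (FrameCoprod A B) where
  min D E :=
    { carrier := D.carrier ∩ E.carrier
      lower := fun h hq => ⟨D.lower h hq.1, E.lower h hq.2⟩
      sSup_left := fun S b h =>
        ⟨D.sSup_left S b fun a ha => (h a ha).1, E.sSup_left S b fun a ha => (h a ha).2⟩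
      sSup_right := fun a S h =>
        ⟨D.sSup_right a S fun b hb => (h b hb).1, E.sSup_right a S fun b hb => (h b hb).2⟩ }

instance : Top (FrameCoprod A B) where
  top :=
    { carrier := Set.univ
      lower := fun _ _ => trivial
      sSup_left := fun _ _ _ => trivial
      sSup_right := fun _ _ _ => trivial }

instance : CompleteLattice (FrameCoprod A B) :=
  { completeLatticeOfInf (FrameCoprod A B) (fun _ =>
      ⟨fun _ hD _ hp => hp _ hD, fun _ hE _ hp _ hD => hE hD hp⟩) with
    inf := Min.min
    inf_le_left := fun _ _ _ h => h.1
    inf_le_right := fun _ _ _ h => h.2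
    le_inf := fun _ _ _ h h' _ hp => ⟨h hp, h' hp⟩
    top := ⊤
    le_top := fun _ _ _ => trivial }

instance : Order.Frame (FrameCoprod A B) :=
  Order.Frame.ofMinimalAxioms
    { inf_sSup_le_iSup_inf := by
        intro D 𝒟
        let E : FrameCoprod A B := ⨆ F ∈ 𝒟, D ⊓ F
        let H : FrameCoprod A B :=
          { carrier := {p | ∀ q ∈ D.carrier, p ⊓ q ∈ E.carrier}
            lower := fun h hq r hr => E.lower (inf_le_inf_right r h) (hq r hr)
            sSup_left := by
              intro S b h q hq
              have := E.sSup_left ((· ⊓ q.1) '' S) (b ⊓ q.2) (by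
                rintro _ ⟨a, ha, rfl⟩
                exact h a ha q hq)
              rwa [sSup_image, ← sSup_inf_eq] at this
            sSup_right := by
              intro a S h q hq
              have := E.sSup_right (a ⊓ q.1) ((· ⊓ q.2) '' S) (by
                rintro _ ⟨b, hb, rfl⟩
                exact h b hb q hq)
              rwa [sSup_image, ← sSup_inf_eq] at this }
        have key : sSup 𝒟 ≤ H := sSup_le fun F hF p hp q hq =>
          (le_iSup₂ (f := fun F (_ : F ∈ 𝒟) => D ⊓ F) F hF)
            ⟨D.lower inf_le_right hq, F.lower inf_le_left hp⟩
        intro p hp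
        have := key hp.2 p hp.1
        rwa [inf_idem] at this }

theorem bot_left_mem (D : FrameCoprod A B) (b : B) : (⊥, b) ∈ D.carrier := by
  simpa using D.sSup_left ∅ b (by simp)

theorem bot_right_mem (D : FrameCoprod A B) (a : A) : (a, ⊥) ∈ D.carrier := by
  simpa using D.sSup_right a ∅ (by simp)

/-- The element `{(x, y) | x ≤ a or y = ⊥}` of `A ⊕ B`. -/
def inlElt (a : A) : FrameCoprod A B where
  carrier := {p | p.1 ≤ a ∨ p.2 = ⊥}
  lower := fun h hq => hq.imp h.1.trans fun hq => bot_unique (h.2.trans hq.le)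
  sSup_left := fun S b h => by
    by_cases hb : b = ⊥
    · exact Or.inr hb
    · exact Or.inl (sSup_le fun a' ha' => (h a' ha').resolve_right hb)
  sSup_right := fun x S h => by
    by_cases hx : x ≤ a
    · exact Or.inl hx
    · exact Or.inr (sSup_eq_bot.2 fun b hb => (h b hb).resolve_left hx)

/-- The first coproduct injection. -/
def inl : FrameHom A (FrameCoprod A B) where
  toFun := inlElt
  map_inf' a a' := by
    apply FrameCoprod.ext
    ext p
    change (p.1 ≤ a ⊓ a' ∨ p.2 = ⊥) ↔ (p.1 ≤ a ∨ p.2 = ⊥) ∧ (p.1 ≤ a' ∨ p.2 = ⊥)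
    rw [le_inf_iff]
    tauto
  map_top' := top_unique fun _ _ => Or.inl le_top
  map_sSup' S := by
    apply le_antisymm
    · rintro ⟨x, b⟩ (h | h)
      · refine lower _ (q := (sSup S, b)) ⟨h, le_rfl⟩ (sSup_left _ S b fun a ha => ?_)
        have h' : (inlElt a : FrameCoprod A B) ≤ sSup (inlElt '' S) :=
          le_sSup (Set.mem_image_of_mem _ ha)
        exact h' (Or.inl (le_refl a))
      · obtain rfl : b = ⊥ := h
        exact bot_right_mem _ x
    · refine sSup_le ?_
      rintro _ ⟨a, ha, rfl⟩ p hp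
      exact hp.imp (fun h => h.trans (le_sSup ha)) id

/-- The element `{(x, y) | y ≤ b or x = ⊥}` of `A ⊕ B`. -/
def inrElt (b : B) : FrameCoprod A B where
  carrier := {p | p.2 ≤ b ∨ p.1 = ⊥}
  lower := fun h hq => hq.imp h.2.trans fun hq => bot_unique (h.1.trans hq.le)
  sSup_left := fun S y h => by
    by_cases hy : y ≤ b
    · exact Or.inl hy
    · exact Or.inr (sSup_eq_bot.2 fun a ha => (h a ha).resolve_left hy)
  sSup_right := fun a S h => by
    by_cases ha : a = ⊥
    · exact Or.inr ha
    · exact Or.inl (sSup_le fun b' hb' => (h b' hb').resolve_right ha)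

/-- The second coproduct injection. -/
def inr : FrameHom B (FrameCoprod A B) where
  toFun := inrElt
  map_inf' b b' := by
    apply FrameCoprod.ext
    ext p
    change (p.2 ≤ b ⊓ b' ∨ p.1 = ⊥) ↔ (p.2 ≤ b ∨ p.1 = ⊥) ∧ (p.2 ≤ b' ∨ p.1 = ⊥)
    rw [le_inf_iff]
    tauto
  map_top' := top_unique fun _ _ => Or.inl le_top
  map_sSup' S := by
    apply le_antisymm
    · rintro ⟨a, y⟩ (h | h)
      · refine lower _ (q := (a, sSup S)) ⟨le_rfl, h⟩ (sSup_right _ a S fun b hb => ?_)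
        have h' : (inrElt b : FrameCoprod A B) ≤ sSup (inrElt '' S) :=
          le_sSup (Set.mem_image_of_mem _ hb)
        exact h' (Or.inl (le_refl b))
      · obtain rfl : a = ⊥ := h
        exact bot_left_mem _ y
    · refine sSup_le ?_
      rintro _ ⟨b, hb, rfl⟩ p hp
      exact hp.imp (fun h => h.trans (le_sSup hb)) id

theorem eq_iSup (D : FrameCoprod A B) : D = ⨆ p ∈ D.carrier, inl p.1 ⊓ inr p.2 := by
  apply le_antisymm
  · intro p hp
    exact le_iSup₂ (f := fun (p : A × B) (_ : p ∈ D.carrier) =>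
      (inl p.1 ⊓ inr p.2 : FrameCoprod A B)) p hp ⟨Or.inl le_rfl, Or.inl le_rfl⟩
  · refine iSup₂_le ?_
    rintro ⟨a, b⟩ hp ⟨x, y⟩ ⟨hx | hx, hy | hy⟩
    · exact D.lower (show (x, y) ≤ (a, b) from ⟨hx, hy⟩) hp
    · obtain rfl : x = ⊥ := hy
      exact D.bot_left_mem y
    · obtain rfl : y = ⊥ := hx
      exact D.bot_right_mem x
    · obtain rfl : x = ⊥ := hy
      exact D.bot_left_mem y

/-- The copairing `A ⊕ B → M` of two frame homomorphisms. -/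
def lift {M : Type w} [Order.Frame M] (f : FrameHom A M) (g : FrameHom B M) :
    FrameHom (FrameCoprod A B) M where
  toFun D := ⨆ p ∈ D.carrier, f p.1 ⊓ g p.2
  map_inf' D E := by
    apply le_antisymm
    · exact le_inf (biSup_mono fun _ h => h.1) (biSup_mono fun _ h => h.2)
    · rw [iSup₂_inf_eq]
      refine iSup₂_le fun p hp => ?_
      rw [inf_iSup₂_eq]
      refine iSup₂_le fun q hq => ?_
      have h : p ⊓ q ∈ (D ⊓ E).carrier := ⟨D.lower inf_le_left hp, E.lower inf_le_right hq⟩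
      refine le_trans (le_of_eq ?_)
        (le_iSup₂ (f := fun (p : A × B) (_ : p ∈ (D ⊓ E).carrier) => f p.1 ⊓ g p.2) (p ⊓ q) h)
      simp only [Prod.fst_inf, Prod.snd_inf, map_inf]
      ac_rfl
  map_top' := top_unique (le_trans (by simp)
    (le_iSup₂ (f := fun (p : A × B) (_ : p ∈ (⊤ : FrameCoprod A B).carrier) => f p.1 ⊓ g p.2)
      ((⊤, ⊤) : A × B) trivial))
  map_sSup' 𝒟 := by
    apply le_antisymm
    · set m : M := sSup ((fun D : FrameCoprod A B => ⨆ p ∈ D.carrier, f p.1 ⊓ g p.2) '' 𝒟) with hm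
      let E : FrameCoprod A B :=
        { carrier := {p | f p.1 ⊓ g p.2 ≤ m}
          lower := fun h hq =>
            (inf_le_inf (OrderHomClass.mono f h.1) (OrderHomClass.mono g h.2)).trans hq
          sSup_left := by
            intro S b h
            change f (sSup S) ⊓ g b ≤ m
            rw [map_sSup, sSup_image, iSup₂_inf_eq]
            exact iSup₂_le h
          sSup_right := by
            intro a S h
            change f a ⊓ g (sSup S) ≤ m
            rw [map_sSup, sSup_image, inf_iSup₂_eq]
            exact iSup₂_le h }
      have key : sSup 𝒟 ≤ E := sSup_le fun D hD p hp =>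
        (le_iSup₂ (f := fun (p : A × B) (_ : p ∈ D.carrier) => f p.1 ⊓ g p.2) p hp).trans
          (le_sSup (Set.mem_image_of_mem _ hD))
      exact iSup₂_le fun p hp => key hp
    · refine sSup_le ?_
      rintro _ ⟨D, hD, rfl⟩
      exact biSup_mono fun p hp => le_sSup hD hp

theorem lift_inl {M : Type w} [Order.Frame M] (f : FrameHom A M) (g : FrameHom B M) (a : A) :
    lift f g (inl a) = f a := by
  apply le_antisymm
  · refine iSup₂_le ?_
    rintro ⟨x, y⟩ (h | h)
    · exact inf_le_left.trans (OrderHomClass.mono f h)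
    · obtain rfl : y = ⊥ := h
      simp
  · exact le_trans (by simp) (le_iSup₂ (f := fun (p : A × B)
      (_ : p ∈ (inl a : FrameCoprod A B).carrier) => f p.1 ⊓ g p.2) (a, ⊤) (Or.inl le_rfl))

theorem lift_inr {M : Type w} [Order.Frame M] (f : FrameHom A M) (g : FrameHom B M) (b : B) :
    lift f g (inr b) = g b := by
  apply le_antisymm
  · refine iSup₂_le ?_
    rintro ⟨x, y⟩ (h | h)
    · exact inf_le_right.trans (OrderHomClass.mono g h)
    · obtain rfl : x = ⊥ := h
      simp
  · exact le_trans (by simp) (le_iSup₂ (f := fun (p : A × B)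
      (_ : p ∈ (inr b : FrameCoprod A B).carrier) => f p.1 ⊓ g p.2) (⊤, b) (Or.inl le_rfl))

end

end FrameCoprod

/-! ## Biframes -/

/-- A biframe `(L⁺, L⁻, L)`: two frames embedded in a frame `L` that they generate. -/
structure Biframe where
  pos : Type u
  neg : Type u
  main : Type u
  [framePos : Order.Frame pos]
  [frameNeg : Order.Frame neg]
  [frameMain : Order.Frame main]
  ePos : FrameHom pos main
  eNeg : FrameHom neg main
  ePos_injective : Function.Injective ePos
  eNeg_injective : Function.Injective eNeg
  generates : ∀ x : main, ∃ S : Set (pos × neg), x = ⨆ p ∈ S, ePos p.1 ⊓ eNeg p.2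

attribute [instance] Biframe.framePos Biframe.frameNeg Biframe.frameMain

/-- The elements of the form `⋁_{k ≤ n} e⁺(x⁺ₖ) ⊓ e⁻(x⁻ₖ)` (finite joins), for frame homomorphisms
`e⁺ : A → M` and `e⁻ : B → M`. -/
def IsFinitaryElement {A : Type u} {B : Type v} {M : Type w} [Order.Frame A] [Order.Frame B]
    [Order.Frame M] (f : FrameHom A M) (g : FrameHom B M) (x : M) : Prop :=
  ∃ s : Finset (A × B), x = s.sup fun p => f p.1 ⊓ g p.2

/-- A congruence on `A ⊕ B` is finitary if it is generated by a relation between finitary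
elements. -/
def FrameCon.IsFinitary {A : Type u} {B : Type v} [Order.Frame A] [Order.Frame B]
    (C : FrameCon (FrameCoprod A B)) : Prop :=
  ∃ R : FrameCoprod A B → FrameCoprod A B → Prop,
    (∀ x y, R x y → IsFinitaryElement FrameCoprod.inl FrameCoprod.inr x ∧
      IsFinitaryElement FrameCoprod.inl FrameCoprod.inr y) ∧
    C = FrameCon.gen R

namespace Biframe

/-- The congruence `C_L` on `L⁺ ⊕ L⁻`: the kernel of the canonical surjection `L⁺ ⊕ L⁻ → L`,
so that `(L⁺ ⊕ L⁻)/C_L` is canonically isomorphic to `L`. -/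
def canonicalCon (L : Biframe.{u}) : FrameCon (FrameCoprod L.pos L.neg) :=
  FrameCon.ker (FrameCoprod.lift L.ePos L.eNeg)

/-- A biframe is finitary if `C_L` is a finitary congruence. -/
def IsFinitary (L : Biframe.{u}) : Prop := L.canonicalCon.IsFinitary

/-- Biframe morphisms: pairs of frame homomorphisms `(f⁺, f⁻)` for which there is a frame
homomorphism of the main components extending both. -/
@[ext]
structure Hom (L : Biframe.{u}) (M : Biframe.{v}) where
  pos : FrameHom L.pos M.pos
  neg : FrameHom L.neg M.neg
  exists_main : ∃ f : FrameHom L.main M.main,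
    (∀ a, f (L.ePos a) = M.ePos (pos a)) ∧ (∀ a, f (L.eNeg a) = M.eNeg (neg a))

/-- The biframe `(2, 2, 2)`, where the two-element frame `2` is `Prop`. -/
def two : Biframe.{0} where
  pos := Prop
  neg := Prop
  main := Prop
  ePos := FrameHom.id Prop
  eNeg := FrameHom.id Prop
  ePos_injective := fun _ _ h => h
  eNeg_injective := fun _ _ h => h
  generates x := ⟨{p | p.1 ∧ p.2 ∧ x}, by
    apply propext
    constructor
    · intro hx
      simp only [iSup_Prop_eq]
      exact ⟨(True, True), ⟨trivial, trivial, hx⟩, trivial, trivial⟩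
    · intro h
      simp only [iSup_Prop_eq] at h
      obtain ⟨_, h, _⟩ := h
      exact h.2.2⟩

/-- The points of a biframe: biframe morphisms to `(2, 2, 2)`. -/
abbrev Point (L : Biframe.{u}) : Type u := Hom L two

/-- `φ⁺(a⁺) = {f | f⁺(a⁺) = 1}`. -/
def phiPos (L : Biframe.{u}) (a : L.pos) : Set L.Point := {f | f.pos a = (⊤ : Prop)}

/-- `φ⁻(a⁻) = {f | f⁻(a⁻) = 1}`. -/
def phiNeg (L : Biframe.{u}) (a : L.neg) : Set L.Point := {f | f.neg a = (⊤ : Prop)}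

end Biframe

/-! ## Bispaces -/

/-- A bispace structure on `X`: a positive and a negative topology. -/
structure Bispace (X : Type u) where
  pos : TopologicalSpace X
  neg : TopologicalSpace X

/-- The bispectrum of a biframe: the positive opens are exactly the sets `φ⁺(a⁺)` and the negative
opens are exactly the sets `φ⁻(a⁻)`. -/
def Biframe.bpt (L : Biframe.{u}) : Bispace L.Point where
  pos :=
    { IsOpen := fun U => ∃ a, U = L.phiPos a
      isOpen_univ := ⟨⊤, by
        ext f
        exact ⟨fun _ => map_top f.pos, fun _ => trivial⟩⟩
      isOpen_inter := by
        rintro _ _ ⟨a, rfl⟩ ⟨b, rfl⟩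
        refine ⟨a ⊓ b, ?_⟩
        ext f
        have h : f.pos (a ⊓ b) = (f.pos a ⊓ f.pos b : Prop) := map_inf f.pos a b
        change (f.pos a = (⊤ : Prop) ∧ f.pos b = (⊤ : Prop)) ↔ f.pos (a ⊓ b) = (⊤ : Prop)
        rw [h]
        exact inf_eq_top_iff.symm
      isOpen_sUnion := by
        intro 𝒰 h𝒰
        refine ⟨sSup {a | L.phiPos a ∈ 𝒰}, ?_⟩
        ext f
        have h : f.pos (sSup {a | L.phiPos a ∈ 𝒰}) = sSup (f.pos '' {a | L.phiPos a ∈ 𝒰}) :=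
          map_sSup f.pos _
        change f ∈ ⋃₀ 𝒰 ↔ f.pos (sSup {a | L.phiPos a ∈ 𝒰}) = True
        rw [h]
        constructor
        · rintro ⟨U, hU, hf⟩
          obtain ⟨a, rfl⟩ := h𝒰 U hU
          exact eq_true ⟨f.pos a, ⟨a, hU, rfl⟩, of_eq_true hf⟩
        · intro hf
          obtain ⟨_, ⟨a, ha, rfl⟩, hp⟩ := of_eq_true hf
          exact ⟨L.phiPos a, ha, eq_true hp⟩ }
  neg :=
    { IsOpen := fun U => ∃ a, U = L.phiNeg a
      isOpen_univ := ⟨⊤, by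
        ext f
        exact ⟨fun _ => map_top f.neg, fun _ => trivial⟩⟩
      isOpen_inter := by
        rintro _ _ ⟨a, rfl⟩ ⟨b, rfl⟩
        refine ⟨a ⊓ b, ?_⟩
        ext f
        have h : f.neg (a ⊓ b) = (f.neg a ⊓ f.neg b : Prop) := map_inf f.neg a b
        change (f.neg a = (⊤ : Prop) ∧ f.neg b = (⊤ : Prop)) ↔ f.neg (a ⊓ b) = (⊤ : Prop)
        rw [h]
        exact inf_eq_top_iff.symm
      isOpen_sUnion := by
        intro 𝒰 h𝒰
        refine ⟨sSup {a | L.phiNeg a ∈ 𝒰}, ?_⟩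
        ext f
        have h : f.neg (sSup {a | L.phiNeg a ∈ 𝒰}) = sSup (f.neg '' {a | L.phiNeg a ∈ 𝒰}) :=
          map_sSup f.neg _
        change f ∈ ⋃₀ 𝒰 ↔ f.neg (sSup {a | L.phiNeg a ∈ 𝒰}) = True
        rw [h]
        constructor
        · rintro ⟨U, hU, hf⟩
          obtain ⟨a, rfl⟩ := h𝒰 U hU
          exact eq_true ⟨f.neg a, ⟨a, hU, rfl⟩, of_eq_true hf⟩
        · intro hf
          obtain ⟨_, ⟨a, ha, rfl⟩, hp⟩ := of_eq_true hf
          exact ⟨L.phiNeg a, ha, eq_true hp⟩ }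

namespace Bispace

section

variable {X : Type u} (T : Bispace X)

/-- The bisubspace on `Y ⊆ X`: both topologies are the subspace topologies. -/
def sub (Y : Set X) : Bispace Y where
  pos := T.pos.induced Subtype.val
  neg := T.neg.induced Subtype.val

/-- The patch topology, generated by the positive and the negative opens together. -/
@[reducible]
def patch : TopologicalSpace X := generateFrom ({U | IsOpen[T.pos] U} ∪ {U | IsOpen[T.neg] U})

/-- The Skula bispace. -/
def skula : Bispace X where
  pos := generateFrom ({U | IsOpen[T.pos] U} ∪ {K | IsClosed[T.neg] K})
  neg := generateFrom ({U | IsOpen[T.neg] U} ∪ {K | IsClosed[T.pos] K})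

/-- The frame `Ω⁺(X)` of positive opens. -/
abbrev OpensPos : Type u := @Opens X T.pos

/-- The frame `Ω⁻(X)` of negative opens. -/
abbrev OpensNeg : Type u := @Opens X T.neg

/-- The relation on `Ω⁺(X) ⊕ Ω⁻(X)` that imposes the inequality `U⁺ ⊓ U⁻ ≤ V⁺ ⊔ V⁻`, in the form
`(U⁺ ⊓ U⁻) ⊓ (V⁺ ⊔ V⁻) = U⁺ ⊓ U⁻`, whenever `U⁺ ∩ U⁻ ⊆ V⁺ ∪ V⁻` in `X`. -/
def finRel (x y : FrameCoprod T.OpensPos T.OpensNeg) : Prop :=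
  ∃ (U V : T.OpensPos) (U' V' : T.OpensNeg),
    (U : Set X) ∩ (U' : Set X) ⊆ (V : Set X) ∪ (V' : Set X) ∧
    x = (FrameCoprod.inl U ⊓ FrameCoprod.inr U') ⊓ (FrameCoprod.inl V ⊔ FrameCoprod.inr V') ∧
    y = FrameCoprod.inl U ⊓ FrameCoprod.inr U'

/-- The finitary frame of opens `Ω_fin(X)`. -/
abbrev OpensFin : Type u := (FrameCon.gen T.finRel).Quot

/-- The inclusion of the frame of opens of a topology in the power set. -/
def opensHom (t : TopologicalSpace X) : FrameHom (@Opens X t) (Set X) where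
  toFun U := U.carrier
  map_inf' _ _ := rfl
  map_top' := rfl
  map_sSup' S := by
    ext x
    simp

/-- The frame homomorphism from `Ω_fin(X)` to the power set of `X` that is the inclusion on
generators. -/
def realize : FrameHom T.OpensFin (Set X) :=
  FrameCon.lift (FrameCoprod.lift (opensHom T.pos) (opensHom T.neg)) (by
    rintro _ _ ⟨U, V, U', V', h, rfl, rfl⟩
    simp only [map_inf, map_sup, FrameCoprod.lift_inl, FrameCoprod.lift_inr]
    exact Set.inter_eq_left.2 h)

theorem realize_inl (U : T.OpensPos) :
    T.realize ((FrameCon.gen T.finRel).quotHom (FrameCoprod.inl U)) = (U : Set X) :=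
  FrameCoprod.lift_inl (opensHom T.pos) (opensHom T.neg) U

theorem realize_inr (U : T.OpensNeg) :
    T.realize ((FrameCon.gen T.finRel).quotHom (FrameCoprod.inr U)) = (U : Set X) :=
  FrameCoprod.lift_inr (opensHom T.pos) (opensHom T.neg) U

/-- The finitary biframe of opens `bΩ_fin(X) = (Ω⁺(X), Ω⁻(X), Ω_fin(X))`. -/
abbrev opensBiframe : Biframe.{u} where
  pos := T.OpensPos
  neg := T.OpensNeg
  main := T.OpensFin
  ePos := (FrameCon.gen T.finRel).quotHom.comp FrameCoprod.inl
  eNeg := (FrameCon.gen T.finRel).quotHom.comp FrameCoprod.inr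
  ePos_injective := fun U V h => by
    have h' := congrArg T.realize h
    exact SetLike.coe_injective ((T.realize_inl U).symm.trans (h'.trans (T.realize_inl V)))
  eNeg_injective := fun U V h => by
    have h' := congrArg T.realize h
    exact SetLike.coe_injective ((T.realize_inr U).symm.trans (h'.trans (T.realize_inr V)))
  generates := fun x => by
    obtain ⟨D, rfl⟩ := FrameCon.proj_surj _ x
    refine ⟨D.carrier, ?_⟩
    conv_lhs => rw [D.eq_iSup]
    rw [FrameCon.proj_iSup]
    exact iSup_congr fun p => FrameCon.proj_iSup _ _

/-- Evaluation of subsets of `X` at a point. -/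
def evalHom (x : X) : FrameHom (Set X) Prop where
  toFun s := x ∈ s
  map_inf' _ _ := rfl
  map_top' := rfl
  map_sSup' S := by
    apply propext
    constructor
    · rintro ⟨s, hs, hx⟩
      exact ⟨x ∈ s, ⟨s, hs, rfl⟩, hx⟩
    · rintro ⟨_, ⟨s, hs, rfl⟩, hx⟩
      exact ⟨s, hs, hx⟩

/-- The unit `ψ : X → bpt(bΩ_fin(X))`, which sends `x` to its pair of neighbourhood maps
`N⁺ₓ(U⁺) = (x ∈ U⁺)`, `N⁻ₓ(U⁻) = (x ∈ U⁻)`. -/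
def unit (x : X) : T.opensBiframe.Point where
  pos := (evalHom x).comp (opensHom T.pos)
  neg := (evalHom x).comp (opensHom T.neg)
  exists_main := ⟨(evalHom x).comp T.realize,
    fun U => congrArg (fun s : Set X => x ∈ s) (T.realize_inl U),
    fun U => congrArg (fun s : Set X => x ∈ s) (T.realize_inr U)⟩

/-- A bihomeomorphism: a homeomorphism for the positive and for the negative topologies. -/
def IsBihomeomorph {Z : Type v} (T : Bispace X) (T' : Bispace Z) (f : X → Z) : Prop :=
  @IsHomeomorph X Z T.pos T'.pos f ∧ @IsHomeomorph X Z T.neg T'.neg f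

/-- A bispace is bisober if the unit `ψ` is a bihomeomorphism. -/
def IsBisober : Prop := IsBihomeomorph T T.opensBiframe.bpt T.unit

end

end Bispace

/-! Everything reduces to sequents `a⁺ ⊓ a⁻ ≤ b⁺ ⊔ b⁻`, each of which may or may not hold at a given
pair of frame homomorphisms `L⁺ → Prop`, `L⁻ → Prop`. Bisobriety of `Y` and closedness in the Skula
patch topology both say that `Y` contains every point satisfying all sequents valid on `Y`.

For bisobriety, the defining inequalities of `Ω_fin(Y)` are exactly the sequents valid on `Y`, so a
point of `bΩ_fin(Y)` is a pair of homomorphisms on `Ω⁺(Y)`, `Ω⁻(Y)` that satisfies them. Every open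
of `Y` is the trace of some `φ⁺(a)` or `φ⁻(a)`, so these pairs pull back to pairs on `L⁺`, `L⁻`
satisfying the sequents valid on `Y`. Such a pair is automatically a point of the biframe
(`Biframe.exists_point_of_satisfies`): if it separated two elements of `L⁺ ⊕ L⁻` with the same image
in `L`, it would violate a single sequent valid at every point. Conversely, a point of the biframe
satisfying these sequents factors through the traces. The map `ψ` is always injective and induces
both topologies, so only its surjectivity is at stake (`isBisober_sub_iff`).

For closedness, the points violating a sequent form a set `φ⁺(a) ∩ φ⁺(b)ᶜ ∩ φ⁻(a') ∩ φ⁻(b')ᶜ`, and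
these sets are a basis of the Skula patch topology. Hence the closed sets are the intersections of
sets defined by sequents. -/

/-! ### Factorization and two-valued homomorphisms -/

/-- A frame homomorphism whose kernel contains that of a surjective frame homomorphism factors
through it. -/
theorem FrameHom.exists_factor {A B M : Type*} [Order.Frame A] [Order.Frame B] [Order.Frame M]
    (h : FrameHom A B) (hs : Function.Surjective h) (f : FrameHom A M)
    (hf : ∀ a b, h a = h b → f a = f b) : ∃ p : FrameHom B M, ∀ a, p (h a) = f a := by
  have hi := Function.surjInv_eq hs
  -- By `hf` the value does not depend on the chosen preimage, so each law may be checked on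
  -- convenient preimages.
  refine ⟨{ toFun := fun b => f (Function.surjInv hs b), map_inf' := ?_, map_top' := ?_,
            map_sSup' := ?_ }, fun a => hf _ _ (hi _)⟩
  · intro a b
    rw [← map_inf]
    exact hf _ _ (by rw [hi, map_inf, hi, hi])
  · rw [← map_top f]
    exact hf _ _ (by rw [hi, map_top])
  · intro S
    rw [← Set.image_image f, ← map_sSup]
    exact hf _ _ (by simp [hi, map_sSup, Set.image_image])

theorem FrameHom.apply_sSup_iff {A : Type*} [Order.Frame A] (f : FrameHom A Prop) (S : Set A) :
    f (sSup S) ↔ ∃ a ∈ S, f a := by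
  rw [map_sSup]
  constructor
  · rintro ⟨_, ⟨a, ha, rfl⟩, h⟩
    exact ⟨a, ha, h⟩
  · rintro ⟨a, ha, h⟩
    exact ⟨_, ⟨a, ha, rfl⟩, h⟩

theorem FrameCoprod.lift_prop_iff {A : Type u} {B : Type v} [Order.Frame A] [Order.Frame B]
    (f : FrameHom A Prop) (g : FrameHom B Prop) (D : FrameCoprod A B) :
    FrameCoprod.lift f g D ↔ ∃ p ∈ D.carrier, f p.1 ∧ g p.2 := by
  change (⨆ p ∈ D.carrier, f p.1 ⊓ g p.2 : Prop) ↔ _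
  simp only [iSup_Prop_eq, exists_prop]
  rfl

/-! ### Points of a biframe and sequents -/

namespace Biframe

variable (L : Biframe.{u})

theorem lift_surjective : Function.Surjective (FrameCoprod.lift L.ePos L.eNeg) := by
  intro x
  obtain ⟨S, rfl⟩ := L.generates x
  refine ⟨⨆ p ∈ S, FrameCoprod.inl p.1 ⊓ FrameCoprod.inr p.2, ?_⟩
  simp only [map_iSup, map_inf, FrameCoprod.lift_inl, FrameCoprod.lift_inr]

variable {L}

/-- The positive component of a point, as a homomorphism to `Prop`. -/
def Hom.posProp (f : L.Point) : FrameHom L.pos Prop := f.pos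

/-- The negative component of a point, as a homomorphism to `Prop`. -/
def Hom.negProp (f : L.Point) : FrameHom L.neg Prop := f.neg

theorem mem_phiPos {f : L.Point} {a : L.pos} : f ∈ L.phiPos a ↔ f.posProp a :=
  ⟨fun h => of_eq_true h, fun h => eq_true h⟩

theorem mem_phiNeg {f : L.Point} {a : L.neg} : f ∈ L.phiNeg a ↔ f.negProp a :=
  ⟨fun h => of_eq_true h, fun h => eq_true h⟩

theorem Hom.exists_mainProp (f : L.Point) : ∃ g : FrameHom L.main Prop,
    (∀ a, g (L.ePos a) = f.posProp a) ∧ (∀ a, g (L.eNeg a) = f.negProp a) := f.exists_main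

theorem Hom.lift_iff (f : L.Point) {g : FrameHom L.main Prop}
    (hp : ∀ a, g (L.ePos a) = f.posProp a) (hn : ∀ a, g (L.eNeg a) = f.negProp a)
    (D : FrameCoprod L.pos L.neg) :
    g (FrameCoprod.lift L.ePos L.eNeg D) ↔ ∃ p ∈ D.carrier, f.posProp p.1 ∧ f.negProp p.2 := by
  change g (⨆ p ∈ D.carrier, L.ePos p.1 ⊓ L.eNeg p.2) ↔ _
  simp only [map_iSup, map_inf, hp, hn, iSup_Prop_eq, exists_prop]
  rfl

/-- The sequent `a⁺ ⊓ a⁻ ≤ b⁺ ⊔ b⁻` holds at a pair of homomorphisms to `Prop`. -/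
def Satisfies {A B : Type*} [Order.Frame A] [Order.Frame B] (f : FrameHom A Prop)
    (g : FrameHom B Prop) (a b : A) (a' b' : B) : Prop :=
  f a → g a' → f b ∨ g b'

/-- A pair of homomorphisms that satisfies all sequents valid on a set of points is a point. -/
theorem exists_point_of_satisfies (Y : Set L.Point) (f : FrameHom L.pos Prop)
    (g : FrameHom L.neg Prop)
    (h : ∀ a b a' b', (∀ y ∈ Y, Satisfies y.posProp y.negProp a b a' b') →
      Satisfies f g a b a' b') :
    ∃ x : L.Point, x.posProp = f ∧ x.negProp = g := by
  -- The copairing must respect the kernel of `L⁺ ⊕ L⁻ → L`; by symmetry one implication is enough.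
  have key : ∀ D E, FrameCoprod.lift L.ePos L.eNeg D = FrameCoprod.lift L.ePos L.eNeg E →
      FrameCoprod.lift f g D → FrameCoprod.lift f g E := by
    intro D E hDE hD
    rw [FrameCoprod.lift_prop_iff] at hD ⊢
    obtain ⟨p, hp, hp1, hp2⟩ := hD
    by_contra hE
    push Not at hE
    -- Each rectangle `q` of `E` has a side that is false under `f` or `g`. If `f q.1` fails, that
    -- side goes into the first join; otherwise `q.2` goes into the second. Both joins are then
    -- false at the pair, while at a point `y` the equality `hDE` makes some rectangle of `E` true,
    -- and with it one of the joins.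
    have hs := h p.1 (sSup {b | ∃ q ∈ E.carrier, ¬ f q.1 ∧ q.1 = b}) p.2
      (sSup {b | ∃ q ∈ E.carrier, f q.1 ∧ q.2 = b}) (by
        intro y _ hy1 hy2
        obtain ⟨m, hm1, hm2⟩ := y.exists_mainProp
        have hyD := (y.lift_iff hm1 hm2 D).2 ⟨p, hp, hy1, hy2⟩
        rw [hDE, y.lift_iff hm1 hm2] at hyD
        obtain ⟨q, hq, hq1, hq2⟩ := hyD
        rw [FrameHom.apply_sSup_iff, FrameHom.apply_sSup_iff]
        by_cases hf : f q.1
        · exact Or.inr ⟨_, ⟨q, hq, hf, rfl⟩, hq2⟩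
        · exact Or.inl ⟨_, ⟨q, hq, hf, rfl⟩, hq1⟩) hp1 hp2
    rw [FrameHom.apply_sSup_iff, FrameHom.apply_sSup_iff] at hs
    rcases hs with ⟨_, ⟨q, _, hq, rfl⟩, hq'⟩ | ⟨_, ⟨q, hq, hq1, rfl⟩, hq2⟩
    · exact hq hq'
    · exact hE q hq hq1 hq2
  obtain ⟨m, hm⟩ := FrameHom.exists_factor _ L.lift_surjective (FrameCoprod.lift f g)
    fun D E hDE => propext ⟨key D E hDE, key E D hDE.symm⟩
  refine ⟨⟨f, g, m, fun a => ?_, fun a => ?_⟩, rfl, rfl⟩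
  · have := hm (FrameCoprod.inl a)
    rwa [FrameCoprod.lift_inl, FrameCoprod.lift_inl] at this
  · have := hm (FrameCoprod.inr a)
    rwa [FrameCoprod.lift_inr, FrameCoprod.lift_inr] at this

theorem Hom.ext_prop {f g : L.Point} (hp : f.posProp = g.posProp) (hn : f.negProp = g.negProp) :
    f = g := Hom.ext hp hn

end Biframe

/-! ### Points of `bΩ_fin(X)` and bisobriety as bijectivity -/

namespace Bispace

variable {X : Type u} (T : Bispace X)

open Biframe

theorem satisfies_of_point (p : T.opensBiframe.Point) {U V : T.OpensPos} {U' V' : T.OpensNeg}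
    (h : (U : Set X) ∩ (U' : Set X) ⊆ (V : Set X) ∪ (V' : Set X)) :
    Satisfies p.posProp p.negProp U V U' V' := by
  -- The main component is pulled back to the coproduct, where it identifies all pairs in `finRel`.
  obtain ⟨m, hp, hn⟩ : ∃ m : FrameHom (FrameCoprod T.OpensPos T.OpensNeg) Prop,
      (∀ W, m (FrameCoprod.inl W) = p.posProp W) ∧ (∀ W, m (FrameCoprod.inr W) = p.negProp W) ∧
      ∀ x y, T.finRel x y → m x = m y := by
    obtain ⟨m, hp, hn⟩ := p.exists_mainProp
    exact ⟨m.comp (FrameCon.gen T.finRel).quotHom, hp, hn, fun x y hxy =>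
      congrArg m ((FrameCon.proj_eq _).2 fun C hC => hC _ _ hxy)⟩
  obtain ⟨hn, hr⟩ := hn
  have hm := hr _ _ ⟨U, V, U', V', h, rfl, rfl⟩
  rw [map_inf, map_inf, map_sup, hp, hp, hn, hn] at hm
  intro h1 h2
  exact (inf_eq_left.1 hm) ⟨h1, h2⟩

/-- The sequents are precisely the generating relations of `Ω_fin(X)`, so the copairing descends to
the quotient. -/
theorem exists_point_of_satisfies (f : FrameHom T.OpensPos Prop) (g : FrameHom T.OpensNeg Prop)
    (h : ∀ (U V : T.OpensPos) (U' V' : T.OpensNeg),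
      (U : Set X) ∩ (U' : Set X) ⊆ (V : Set X) ∪ (V' : Set X) → Satisfies f g U V U' V') :
    ∃ p : T.opensBiframe.Point, p.posProp = f ∧ p.negProp = g := by
  have hr : ∀ x y, T.finRel x y → FrameCoprod.lift f g x = FrameCoprod.lift f g y := by
    rintro _ _ ⟨U, V, U', V', hUV, rfl, rfl⟩
    rw [map_inf, map_inf, map_sup, FrameCoprod.lift_inl, FrameCoprod.lift_inl,
      FrameCoprod.lift_inr, FrameCoprod.lift_inr]
    exact inf_eq_left.2 fun hU => h U V U' V' hUV hU.1 hU.2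
  exact ⟨⟨f, g, FrameCon.lift (FrameCoprod.lift f g) hr, FrameCoprod.lift_inl f g,
    FrameCoprod.lift_inr f g⟩, rfl, rfl⟩

theorem isHomeomorph_of_bijective {Z : Type*} (t : TopologicalSpace X) (s : TopologicalSpace Z)
    {f : X → Z} (hf : Function.Bijective f) (h : t = s.induced f) :
    @IsHomeomorph X Z t s f :=
  isHomeomorph_iff_isEmbedding_surjective.2 ⟨⟨⟨h⟩, hf.1⟩, hf.2⟩

theorem unit_preimage_phiPos (U : T.OpensPos) : T.unit ⁻¹' T.opensBiframe.phiPos U = U :=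
  Set.ext fun _ => mem_phiPos

theorem unit_preimage_phiNeg (U : T.OpensNeg) : T.unit ⁻¹' T.opensBiframe.phiNeg U = U :=
  Set.ext fun _ => mem_phiNeg

/-- The opens of `X` are exactly the preimages under `ψ` of the sets `φ⁺(U)`, respectively `φ⁻(U)`.
Both topologies are thus induced by `ψ`, and a bijection inducing the topology is a homeomorphism.
-/
theorem isBisober_iff_bijective : T.IsBisober ↔ Function.Bijective T.unit := by
  refine ⟨fun h => @IsHomeomorph.bijective _ _ T.pos T.opensBiframe.bpt.pos _ h.1, fun h => ⟨isHomeomorph_of_bijective _ _ h ?_,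
    isHomeomorph_of_bijective _ _ h ?_⟩⟩
  · refine TopologicalSpace.ext_iff.2 fun U => ⟨fun hU => ?_, ?_⟩
    · exact ⟨_, ⟨@Opens.mk _ T.pos U hU, rfl⟩, T.unit_preimage_phiPos _⟩
    · rintro ⟨_, ⟨V, rfl⟩, rfl⟩
      rw [unit_preimage_phiPos]
      exact @Opens.is_open' _ T.pos V
  · refine TopologicalSpace.ext_iff.2 fun U => ⟨fun hU => ?_, ?_⟩
    · exact ⟨_, ⟨@Opens.mk _ T.neg U hU, rfl⟩, T.unit_preimage_phiNeg _⟩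
    · rintro ⟨_, ⟨V, rfl⟩, rfl⟩
      rw [unit_preimage_phiNeg]
      exact @Opens.is_open' _ T.neg V

end Bispace

/-! ### Bisober sets of points -/

namespace Biframe

variable {L : Biframe.{u}} (Y : Set L.Point)

/-- The trace on `Y` of the positive opens of the bispectrum. -/
def resPos : FrameHom L.pos (L.bpt.sub Y).OpensPos where
  toFun a := @Opens.mk _ (L.bpt.sub Y).pos (Subtype.val ⁻¹' L.phiPos a) ⟨_, ⟨a, rfl⟩, rfl⟩
  map_inf' a b := by
    refine SetLike.coe_injective (Set.ext fun y => ?_)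
    change y.1 ∈ L.phiPos _ ↔ y.1 ∈ L.phiPos _ ∧ y.1 ∈ L.phiPos _
    rw [mem_phiPos, mem_phiPos, mem_phiPos, map_inf]
    rfl
  map_top' := by
    refine SetLike.coe_injective (Set.ext fun y => ?_)
    change y.1 ∈ L.phiPos _ ↔ True
    rw [mem_phiPos, map_top]
    rfl
  map_sSup' S := by
    refine SetLike.coe_injective (Set.ext fun y => ?_)
    rw [@Opens.coe_sSup _ (L.bpt.sub Y).pos]
    change y.1 ∈ L.phiPos _ ↔ _
    rw [mem_phiPos, FrameHom.apply_sSup_iff]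
    simp only [Set.mem_image, Set.iUnion_exists, Set.biUnion_and', Set.iUnion_iUnion_eq_right,
      Set.mem_iUnion, exists_prop]
    exact exists_congr fun a => and_congr_right fun _ => mem_phiPos.symm

/-- The trace on `Y` of the negative opens of the bispectrum. -/
def resNeg : FrameHom L.neg (L.bpt.sub Y).OpensNeg where
  toFun a := @Opens.mk _ (L.bpt.sub Y).neg (Subtype.val ⁻¹' L.phiNeg a) ⟨_, ⟨a, rfl⟩, rfl⟩
  map_inf' a b := by
    refine SetLike.coe_injective (Set.ext fun y => ?_)
    change y.1 ∈ L.phiNeg _ ↔ y.1 ∈ L.phiNeg _ ∧ y.1 ∈ L.phiNeg _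
    rw [mem_phiNeg, mem_phiNeg, mem_phiNeg, map_inf]
    rfl
  map_top' := by
    refine SetLike.coe_injective (Set.ext fun y => ?_)
    change y.1 ∈ L.phiNeg _ ↔ True
    rw [mem_phiNeg, map_top]
    rfl
  map_sSup' S := by
    refine SetLike.coe_injective (Set.ext fun y => ?_)
    rw [@Opens.coe_sSup _ (L.bpt.sub Y).neg]
    change y.1 ∈ L.phiNeg _ ↔ _
    rw [mem_phiNeg, FrameHom.apply_sSup_iff]
    simp only [Set.mem_image, Set.iUnion_exists, Set.biUnion_and', Set.iUnion_iUnion_eq_right,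
      Set.mem_iUnion, exists_prop]
    exact exists_congr fun a => and_congr_right fun _ => mem_phiNeg.symm

theorem mem_resPos {a : L.pos} {y : Y} :
    y ∈ (resPos Y a : Set Y) ↔ y.1.posProp a :=
  mem_phiPos (f := y.1)

theorem mem_resNeg {a : L.neg} {y : Y} :
    y ∈ (resNeg Y a : Set Y) ↔ y.1.negProp a :=
  mem_phiNeg (f := y.1)

theorem resPos_surjective : Function.Surjective (resPos Y) := by
  rintro ⟨_, _, ⟨a, rfl⟩, rfl⟩
  exact ⟨a, rfl⟩

theorem resNeg_surjective : Function.Surjective (resNeg Y) := by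
  rintro ⟨_, _, ⟨a, rfl⟩, rfl⟩
  exact ⟨a, rfl⟩

theorem unit_posProp (y : Y) (a : L.pos) :
    ((L.bpt.sub Y).unit y).posProp (resPos Y a) ↔ y.1.posProp a := mem_resPos Y

theorem unit_negProp (y : Y) (a : L.neg) :
    ((L.bpt.sub Y).unit y).negProp (resNeg Y a) ↔ y.1.negProp a := mem_resNeg Y

theorem unit_injective : Function.Injective (L.bpt.sub Y).unit := by
  intro y z h
  refine Subtype.ext (Hom.ext_prop ?_ ?_)
  · ext a
    rw [← unit_posProp, h, unit_posProp]
  · ext a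
    rw [← unit_negProp, h, unit_negProp]

theorem resPos_inter_subset {a b : L.pos} {a' b' : L.neg} :
    (resPos Y a : Set Y) ∩ (resNeg Y a' : Set Y) ⊆ (resPos Y b : Set Y) ∪ (resNeg Y b' : Set Y) ↔
      ∀ y ∈ Y, Satisfies y.posProp y.negProp a b a' b' := by
  constructor
  · intro h y hy h1 h2
    exact (h (a := ⟨y, hy⟩) ⟨(mem_resPos Y).2 h1, (mem_resNeg Y).2 h2⟩).imp
      (mem_resPos Y).1 (mem_resNeg Y).1
  · rintro h y ⟨h1, h2⟩
    exact (h y y.2 ((mem_resPos Y).1 h1) ((mem_resNeg Y).1 h2)).imp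
      (mem_resPos Y).2 (mem_resNeg Y).2

/-- A set of points of a biframe is bisober if and only if it contains every point that satisfies
all sequents valid on it. -/
theorem isBisober_sub_iff : (L.bpt.sub Y).IsBisober ↔ ∀ x : L.Point,
    (∀ a b a' b', (∀ y ∈ Y, Satisfies y.posProp y.negProp a b a' b') →
      Satisfies x.posProp x.negProp a b a' b') → x ∈ Y := by
  rw [Bispace.isBisober_iff_bijective]
  constructor
  · rintro ⟨-, hs⟩ x hx
    -- Equal traces make the sequent `a ⊓ ⊤ ≤ b ⊔ ⊥` valid on `Y`, hence true at `x`; so `x` factors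
    -- through the traces.
    have hpos : ∀ a b, resPos Y a = resPos Y b → x.posProp a → x.posProp b := by
      intro a b hab ha
      have h := hx a b ⊤ ⊥ ((resPos_inter_subset Y).1 (by rw [hab]; exact fun y hy => Or.inl hy.1))
        ha (by rw [map_top]; trivial)
      rw [map_bot] at h
      exact h.resolve_right id
    have hneg : ∀ a b, resNeg Y a = resNeg Y b → x.negProp a → x.negProp b := by
      intro a b hab ha
      have h := hx ⊤ ⊥ a b ((resPos_inter_subset Y).1 (by rw [hab]; exact fun y hy => Or.inr hy.2))
        (by rw [map_top]; trivial) ha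
      rw [map_bot] at h
      exact h.resolve_left id
    obtain ⟨f, hf⟩ := FrameHom.exists_factor _ (resPos_surjective Y) x.posProp
      fun a b h => propext ⟨hpos a b h, hpos b a h.symm⟩
    obtain ⟨g, hg⟩ := FrameHom.exists_factor _ (resNeg_surjective Y) x.negProp
      fun a b h => propext ⟨hneg a b h, hneg b a h.symm⟩
    obtain ⟨p, hp, hn⟩ := (L.bpt.sub Y).exists_point_of_satisfies f g (by
      intro U V U' V' h
      obtain ⟨a, rfl⟩ := resPos_surjective Y U
      obtain ⟨b, rfl⟩ := resPos_surjective Y V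
      obtain ⟨a', rfl⟩ := resNeg_surjective Y U'
      obtain ⟨b', rfl⟩ := resNeg_surjective Y V'
      rw [Satisfies, hf, hf, hg, hg]
      exact hx a b a' b' ((resPos_inter_subset Y).1 h))
    obtain ⟨y, rfl⟩ := hs p
    have hyx : y.1 = x := by
      refine Hom.ext_prop ?_ ?_
      · ext a
        rw [← unit_posProp, hp, hf]
      · ext a
        rw [← unit_negProp, hn, hg]
    exact hyx ▸ y.2
  · refine fun h => ⟨unit_injective Y, fun p => ?_⟩
    -- Pulling `p` back along the traces yields a pair on `L⁺`, `L⁻` satisfying the sequents valid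
    -- on `Y`; it is a point, and by `h` it lies in `Y`.
    have hsat : ∀ a b a' b', (∀ y ∈ Y, Satisfies y.posProp y.negProp a b a' b') →
        Satisfies (p.posProp.comp (resPos Y)) (p.negProp.comp (resNeg Y)) a b a' b' :=
      fun a b a' b' hv =>
        (L.bpt.sub Y).satisfies_of_point p ((resPos_inter_subset Y).2 hv)
    obtain ⟨x, hxp, hxn⟩ := exists_point_of_satisfies Y _ _ hsat
    refine ⟨⟨x, h x ?_⟩, Hom.ext_prop ?_ ?_⟩
    · rw [hxp, hxn]
      exact hsat
    · ext U
      obtain ⟨a, rfl⟩ := resPos_surjective Y U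
      exact (unit_posProp Y _ a).trans (by rw [hxp]; rfl)
    · ext U
      obtain ⟨a, rfl⟩ := resNeg_surjective Y U
      exact (unit_negProp Y _ a).trans (by rw [hxn]; rfl)

/-! ### Sets defined by sequents and the Skula patch topology -/

variable (L)

/-- The set of points at which the sequent `a⁺ ⊓ a⁻ ≤ b⁺ ⊔ b⁻` holds. -/
def sequentSet (a b : L.pos) (a' b' : L.neg) : Set L.Point :=
  (L.phiPos a)ᶜ ∪ L.phiPos b ∪ (L.phiNeg a')ᶜ ∪ L.phiNeg b'

variable {L}

theorem mem_sequentSet {x : L.Point} {a b : L.pos} {a' b' : L.neg} :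
    x ∈ L.sequentSet a b a' b' ↔ Satisfies x.posProp x.negProp a b a' b' := by
  simp only [sequentSet, Set.mem_union, Set.mem_compl_iff, mem_phiPos, mem_phiNeg, Satisfies]
  tauto

theorem isBisober_sub_iff_iInter : (L.bpt.sub Y).IsBisober ↔
    ∃ (ι : Type u) (a b : ι → L.pos) (a' b' : ι → L.neg),
      Y = ⋂ i, L.sequentSet (a i) (b i) (a' i) (b' i) := by
  rw [isBisober_sub_iff]
  constructor
  · intro h
    -- The family of all sequents valid on `Y` cuts out the smallest intersection of this form
    -- containing `Y`.
    refine ⟨{s : (L.pos × L.pos) × (L.neg × L.neg) //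
      ∀ y ∈ Y, Satisfies y.posProp y.negProp s.1.1 s.1.2 s.2.1 s.2.2},
      fun s => s.1.1.1, fun s => s.1.1.2, fun s => s.1.2.1, fun s => s.1.2.2, ?_⟩
    ext x
    simp only [Set.mem_iInter, mem_sequentSet]
    exact ⟨fun hx s => s.2 x hx, fun hx => h x fun a b a' b' hv => hx ⟨((a, b), (a', b')), hv⟩⟩
  · rintro ⟨ι, a, b, a', b', rfl⟩ x hx
    simp only [Set.mem_iInter, mem_sequentSet] at hx ⊢
    exact fun i => hx _ _ _ _ fun y hy => hy i

theorem phiPos_top : L.phiPos ⊤ = Set.univ :=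
  Set.eq_univ_of_forall fun f => map_top f.pos

theorem phiNeg_top : L.phiNeg ⊤ = Set.univ :=
  Set.eq_univ_of_forall fun f => map_top f.neg

theorem phiPos_bot : L.phiPos ⊥ = ∅ :=
  Set.eq_empty_of_forall_notMem fun f h => by simpa using mem_phiPos.1 h

theorem phiNeg_bot : L.phiNeg ⊥ = ∅ :=
  Set.eq_empty_of_forall_notMem fun f h => by simpa using mem_phiNeg.1 h

theorem isOpen_skula_patch_of_pos {U : Set L.Point} (h : IsOpen[L.bpt.skula.pos] U) :
    IsOpen[L.bpt.skula.patch] U := isOpen_generateFrom_of_mem (Or.inl h)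

theorem isOpen_skula_patch_of_neg {U : Set L.Point} (h : IsOpen[L.bpt.skula.neg] U) :
    IsOpen[L.bpt.skula.patch] U := isOpen_generateFrom_of_mem (Or.inr h)

/-- The set is open in the positive Skula topology and its complement in the negative one; the patch
topology contains both. -/
theorem isClopen_phiPos (a : L.pos) : @IsClopen _ L.bpt.skula.patch (L.phiPos a) := by
  have ho : IsOpen[L.bpt.pos] (L.phiPos a) := ⟨a, rfl⟩
  refine ⟨@IsClosed.mk _ L.bpt.skula.patch _ (isOpen_skula_patch_of_neg (isOpen_generateFrom_of_mem (Or.inr ?_))),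
    isOpen_skula_patch_of_pos (isOpen_generateFrom_of_mem (Or.inl ho))⟩
  exact @IsOpen.isClosed_compl _ L.bpt.pos _ ho

theorem isClopen_phiNeg (a : L.neg) : @IsClopen _ L.bpt.skula.patch (L.phiNeg a) := by
  have ho : IsOpen[L.bpt.neg] (L.phiNeg a) := ⟨a, rfl⟩
  refine ⟨@IsClosed.mk _ L.bpt.skula.patch _ (isOpen_skula_patch_of_pos (isOpen_generateFrom_of_mem (Or.inr ?_))),
    isOpen_skula_patch_of_neg (isOpen_generateFrom_of_mem (Or.inl ho))⟩
  exact @IsOpen.isClosed_compl _ L.bpt.neg _ ho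

theorem isClosed_sequentSet (a b : L.pos) (a' b' : L.neg) :
    IsClosed[L.bpt.skula.patch] (L.sequentSet a b a' b') := by
  let _ := L.bpt.skula.patch
  exact (((isClopen_phiPos a).compl.union (isClopen_phiPos b)).union
    (isClopen_phiNeg a').compl).union (isClopen_phiNeg b') |>.isClosed

variable (L)

/-- The complements of the sets `sequentSet` form a basis of the patch topology of the Skula
bispace. -/
theorem isTopologicalBasis_sequentSet_compl : @IsTopologicalBasis _ L.bpt.skula.patch
    {U | ∃ a b a' b', U = (L.sequentSet a b a' b')ᶜ} := by
  set B : Set (Set L.Point) := {U | ∃ a b a' b', U = (L.sequentSet a b a' b')ᶜ} with hB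
  refine @IsTopologicalBasis.mk _ L.bpt.skula.patch _ ?_ ?_ (le_antisymm ?_ ?_)
  · rintro _ ⟨a, b, a', b', rfl⟩ _ ⟨c, d, c', d', rfl⟩ x hx
    -- Two sequents both fail exactly when the one with met left sides and joined right sides fails,
    -- because the values lie in `Prop`.
    refine ⟨_, ⟨a ⊓ c, b ⊔ d, a' ⊓ c', b' ⊔ d', rfl⟩, ?_⟩
    have : (L.sequentSet (a ⊓ c) (b ⊔ d) (a' ⊓ c') (b' ⊔ d'))ᶜ =
        (L.sequentSet a b a' b')ᶜ ∩ (L.sequentSet c d c' d')ᶜ := by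
      ext y
      simp only [Set.mem_inter_iff, Set.mem_compl_iff, mem_sequentSet, Satisfies, map_inf, map_sup,
        inf_Prop_eq, sup_Prop_eq]
      tauto
    exact ⟨this ▸ hx, this.le⟩
  · refine Set.eq_univ_of_forall fun x => ⟨_, ⟨⊤, ⊥, ⊤, ⊥, rfl⟩, ?_⟩
    simp [sequentSet, phiPos_top, phiPos_bot, phiNeg_top, phiNeg_bot]
  · refine le_generateFrom ?_
    rintro _ ⟨a, b, a', b', rfl⟩
    exact (isClosed_sequentSet a b a' b').isOpen_compl
  -- Setting the other three entries to `⊤` on the left and `⊥` on the right makes each `φ⁺(a)`,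
  -- `φ⁻(a)` and each of their complements a basic set.
  · have hpos : ∀ a, IsOpen[generateFrom B] (L.phiPos a) := fun a =>
      isOpen_generateFrom_of_mem ⟨a, ⊥, ⊤, ⊥, by
        simp [sequentSet, phiPos_bot, phiNeg_top, phiNeg_bot]⟩
    have hneg : ∀ a, IsOpen[generateFrom B] (L.phiNeg a) := fun a =>
      isOpen_generateFrom_of_mem ⟨⊤, ⊥, a, ⊥, by
        simp [sequentSet, phiPos_bot, phiPos_top, phiNeg_bot]⟩
    have hpos' : ∀ a, IsOpen[generateFrom B] (L.phiPos a)ᶜ := fun a =>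
      isOpen_generateFrom_of_mem ⟨⊤, a, ⊤, ⊥, by
        simp [sequentSet, phiPos_top, phiNeg_top, phiNeg_bot]⟩
    have hneg' : ∀ a, IsOpen[generateFrom B] (L.phiNeg a)ᶜ := fun a =>
      isOpen_generateFrom_of_mem ⟨⊤, ⊥, ⊤, a, by
        simp [sequentSet, phiPos_bot, phiPos_top, phiNeg_top]⟩
    have hp : generateFrom B ≤ L.bpt.skula.pos := by
      refine le_generateFrom ?_
      rintro U (⟨a, rfl⟩ | hU)
      · exact hpos a
      · obtain ⟨a, ha⟩ := hU.isOpen_compl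
        rw [← compl_compl U, ha]
        exact hneg' a
    have hn : generateFrom B ≤ L.bpt.skula.neg := by
      refine le_generateFrom ?_
      rintro U (⟨a, rfl⟩ | hU)
      · exact hneg a
      · obtain ⟨a, ha⟩ := hU.isOpen_compl
        rw [← compl_compl U, ha]
        exact hpos' a
    refine le_generateFrom ?_
    rintro U (hU | hU)
    · exact hp U hU
    · exact hn U hU

variable {L}

theorem isClosed_skula_patch_iff : IsClosed[L.bpt.skula.patch] Y ↔
    ∃ (ι : Type u) (a b : ι → L.pos) (a' b' : ι → L.neg),
      Y = ⋂ i, L.sequentSet (a i) (b i) (a' i) (b' i) := by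
  let _ := L.bpt.skula.patch
  constructor
  · intro h
    refine ⟨{s : (L.pos × L.pos) × (L.neg × L.neg) // Y ⊆ L.sequentSet s.1.1 s.1.2 s.2.1 s.2.2},
      fun s => s.1.1.1, fun s => s.1.1.2, fun s => s.1.2.1, fun s => s.1.2.2, ?_⟩
    refine (Set.subset_iInter fun s => s.2).antisymm fun x hx => ?_
    by_contra hxY
    -- A basic neighbourhood of `x` that misses `Y` is a sequent valid on `Y` and violated at `x`.
    obtain ⟨_, ⟨a, b, a', b', rfl⟩, hx', hs⟩ :=
      L.isTopologicalBasis_sequentSet_compl.exists_subset_of_mem_open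
        (Set.mem_compl hxY) h.isOpen_compl
    exact hx' (Set.mem_iInter.1 hx ⟨((a, b), (a', b')), Set.compl_subset_compl.1 hs⟩)
  · rintro ⟨ι, a, b, a', b', rfl⟩
    exact isClosed_iInter fun i => isClosed_sequentSet _ _ _ _

end Biframe

theorem mainTheorem7 (L : Biframe.{u}) (hL : L.IsFinitary) (Y : Set L.Point) :
    ((L.bpt.sub Y).IsBisober ↔ IsClosed[L.bpt.skula.patch] Y) ∧
    ((L.bpt.sub Y).IsBisober ↔
      ∃ (ι : Type u) (aPos bPos : ι → L.pos) (aNeg bNeg : ι → L.neg),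
        Y = ⋂ i, ((L.phiPos (aPos i))ᶜ ∪ L.phiPos (bPos i) ∪
          (L.phiNeg (aNeg i))ᶜ ∪ L.phiNeg (bNeg i))) :=
  ⟨(Biframe.isBisober_sub_iff_iInter Y).trans (Biframe.isClosed_skula_patch_iff Y).symm,
    Biframe.isBisober_sub_iff_iInter Y⟩
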